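/- **Theorem (selection rules).** Let $\hbar,\mu,c>0$ and $e\in\mathbb R$, let $\phi^{\rm ext}(\mathbf x)=\phi(|\mathbf x|)$ be a radial electrostatic potential with $\phi\in L^1_{\rm loc}((0,\infty);\mathbb R)$, and let $\mathbf A(\mathbf x)=\tfrac12\,\mathbf B\times\mathbf x$ be the vector potential of a uniform magnetic field $\mathbf B\in\mathbb R^3$. In spherical coordinates $x_1=r\sin\theta\cos\varphi$, $x_2=r\sin\theta\sin\varphi$, $x_3=r\cos\theta$ put $$F_l^m(\theta)=\sin^{|m|}\theta\;\frac{d^{\,l+|m|}}{dt^{\,l+|m|}}(t^2-1)^l\Big|_{t=\cos\theta},$$ so that $F_l^m(\theta)e^{im\varphi}$, for integers $l\ge0$ and $|m|\le l$, are the spherical harmonics up to normalization. Let $$\psi_k=R_{nl}(r)F_l^m(\theta)e^{im\varphi},\qquad \psi_{k'}=R_{n'l'}(r)F_{l'}^{m'}(\theta)e^{im'\varphi},\qquad |m|\le l,\ |m'|\le l',$$ with radial functions $R_{nl},R_{n'l'}\in C^1((0,\infty);\mathbb C)$, be nonzero stationary states of real energies $E_k,E_{k'}$, i.e. weak solutions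 on $\mathbb R^3\setminus\{0\}$ of the stationary Schrödinger equation $$\frac1{2\mu}\Big[-i\hbar\nabla-\frac ec\mathbf A\Big]^2\psi+e\phi(|\mathbf x|)\psi=E\psi ,$$ or, both of them, of the equation obtained from it by neglecting the term $\frac{e^2}{2\mu c^2}|\mathbf A|^2\psi$; assume that $\psi_k$, $\psi_{k'}$, $[-i\hbar\nabla-\frac ec\mathbf A]\psi_k$ and $[-i\hbar\nabla-\frac ec\mathbf A]\psi_{k'}$ are square integrable on $\mathbb R^3$. Define the radiation amplitude in the dipole approximation by $$\mathbf J_{kk'}=\int_{\mathbb R^3}\Big\{\Big(\big[-i\hbar\nabla-\tfrac ec\mathbf A\big]\psi_k\Big)\overline{\psi_{k'}}+\Big(\big[i\hbar\nabla-\tfrac ec\mathbf A\big]\overline{\psi_{k'}}\Big)\psi_k\Big\}\,d\mathbf y .$$ Then this integral converges absolutely, and $\mathbf J_{kk'}=0$ if either $l'\ne l\pm1$ or $m'\notin\{m,m+1,m-1\}$. -/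

import Mathlib

open MeasureTheory

noncomputable section

namespace DipoleRadiation

/-- Euclidean space `ℝ³`; the coordinates `x 0, x 1, x 2` are `x₁, x₂, x₃`. -/
abbrev Space : Type := EuclideanSpace ℝ (Fin 3)

/-- The polar angle `θ` of `x`: `x₃ = r cos θ`. -/
def polarAngle (x : Space) : ℝ := Real.arccos (x 2 / ‖x‖)

/-- The azimuthal angle `φ` of `x`: `x₁ = r sin θ cos φ`, `x₂ = r sin θ sin φ`. -/
def azimuth (x : Space) : ℝ := Complex.arg ⟨x 0, x 1⟩

/-- The real function `F_l^m(θ)`, the associated Legendre function of `cos θ`, up to normalization: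
`F_l^m(θ) = sin^{|m|} θ · (d/dt)^{l+|m|} (t² - 1)^l` at `t = cos θ`.
For `|m| ≤ l` the functions `F_l^m(θ) e^{imφ}` are, up to nonzero real factors, the
spherical harmonics `Y_l^m`. -/
def polarFactor (l : ℕ) (m : ℤ) (θ : ℝ) : ℝ :=
  Real.sin θ ^ m.natAbs *
    (Polynomial.derivative^[l + m.natAbs] ((Polynomial.X ^ 2 - 1 : Polynomial ℝ) ^ l)).eval
      (Real.cos θ)

/-- The wave function `R(r) F_l^m(θ) e^{imφ}`, as a function of the Cartesian coordinates. -/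
def separatedState (R : ℝ → ℂ) (l : ℕ) (m : ℤ) (x : Space) : ℂ :=
  R ‖x‖ * (polarFactor l m (polarAngle x) : ℂ) * Complex.exp (Complex.I * m * azimuth x)

/-- The vector potential `A(x) = B × x / 2` of a uniform magnetic field `B`. -/
def uniformVectorPotential (B x : Space) : Space :=
  WithLp.toLp 2 ((1 / 2 : ℝ) • crossProduct B.ofLp x.ofLp)

/-- The partial derivative `∂f/∂x_p`. -/
def partialDeriv (p : Fin 3) (f : Space → ℂ) (x : Space) : ℂ :=
  fderiv ℝ f x (EuclideanSpace.single p 1)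

/-- The vector field `[-iℏ∇ - (e/c) A] ψ`. -/
def kineticMomentum (hbar e c : ℝ) (A : Space → Space) (ψ : Space → ℂ) (x : Space) :
    EuclideanSpace ℂ (Fin 3) :=
  WithLp.toLp 2 fun p =>
    -Complex.I * hbar * partialDeriv p ψ x - (e / c : ℝ) * (A x p : ℝ) * ψ x

/-- `R(r) F_l^m(θ) e^{imφ}` is a stationary state of energy `E`, of finite kinetic energy, of an
electron in the radial electrostatic potential `φ(|x|)` and the uniform magnetic field `B`.

The eigenvalue equation is
`(1/2μ) [-iℏ∇ - (e/c) A]² ψ - (1 - κ) (e²/2μc²) |A|² ψ + e φ(|x|) ψ = E ψ`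
with `A = B × x / 2`, in the weak sense on `ℝ³ ∖ {0}`. For `κ = 1` it is the full magnetic
Schrödinger equation; for `κ = 0` it is the equation in which the term quadratic in the
magnetic field is neglected,
`-(ℏ²/2μ) Δψ + (iℏe/μc) A·∇ψ + e φ(|x|) ψ = E ψ`. -/
structure IsStationaryState (hbar μ e c κ : ℝ) (φ : ℝ → ℝ) (B : Space) (E : ℝ)
    (R : ℝ → ℂ) (l : ℕ) (m : ℤ) : Prop where
  contDiffOn : ContDiffOn ℝ 1 R (Set.Ioi 0)
  ne_zero : ∃ r : ℝ, 0 < r ∧ R r ≠ 0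
  memLp : MemLp (separatedState R l m) 2 volume
  kinetic_memLp :
    MemLp (kineticMomentum hbar e c (uniformVectorPotential B) (separatedState R l m)) 2 volume
  eigen : ∀ χ : Space → ℂ, ContDiff ℝ (⊤ : ℕ∞) χ → HasCompactSupport χ →
    (0 : Space) ∉ tsupport χ →
    (1 / (2 * μ) : ℝ) *
        (∫ x, ∑ p, kineticMomentum hbar e c (uniformVectorPotential B) (separatedState R l m) x p *
          starRingEnd ℂ (kineticMomentum hbar e c (uniformVectorPotential B) χ x p))
      - ((1 - κ) * e ^ 2 / (2 * μ * c ^ 2) : ℝ) *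
        (∫ x, ((‖uniformVectorPotential B x‖ ^ 2 : ℝ) : ℂ) *
          separatedState R l m x * starRingEnd ℂ (χ x))
      + (e : ℂ) * (∫ x, (φ ‖x‖ : ℂ) * separatedState R l m x * starRingEnd ℂ (χ x))
      = (E : ℂ) * ∫ x, separatedState R l m x * starRingEnd ℂ (χ x)

/-- The cross-current
`([-iℏ∇ - (e/c) A] ψ) ψ̄' + ([iℏ∇ - (e/c) A] ψ̄') ψ` of two wave functions. -/
def crossCurrent (hbar e c : ℝ) (A : Space → Space) (ψ ψ' : Space → ℂ) (x : Space) :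
    EuclideanSpace ℂ (Fin 3) :=
  WithLp.toLp 2 fun p =>
    (-Complex.I * hbar * partialDeriv p ψ x - (e / c : ℝ) * (A x p : ℝ) * ψ x) *
        starRingEnd ℂ (ψ' x)
      + (Complex.I * hbar * partialDeriv p (fun y => starRingEnd ℂ (ψ' y)) x
          - (e / c : ℝ) * (A x p : ℝ) * starRingEnd ℂ (ψ' x)) * ψ x

/-- The dipole approximation of the limiting radiation amplitude: the integral of the
cross-current over the whole space. -/
def dipoleAmplitude (hbar e c : ℝ) (A : Space → Space) (ψ ψ' : Space → ℂ) :
    EuclideanSpace ℂ (Fin 3) :=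
  ∫ x, crossCurrent hbar e c A ψ ψ' x

end DipoleRadiation

end

/-! On each sphere `|x| = r` the cross-current is a combination, with coefficients depending only
on `r`, of `∂ₚH · K`, `H · ∂ₚK` and `x_q H K`, where `H` and `K` are solid harmonics of magnetic
numbers `m` and `-m'`. The integral of a homogeneous polynomial over a sphere is a multiple of its
integral against `exp (-|x|²)`, where integration by parts has no boundary terms. It shows that
harmonic polynomials of different degrees are orthogonal, and `∂ₚH` is harmonic of degree `l - 1`;
that infinitesimal rotations integrate to zero, while `∂₁ ± i∂₂` shift the magnetic number by `±1`
and `∂₃` preserves it; and that the integral of `x_q H K` is half that of `∂_q (H K)`.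

The solid harmonics are the coefficients, in powers of `v`, of `(∑ xᵢ ζᵢ(v))^l` with `ζ` isotropic,
which makes them harmonic. On a sphere `∑ xᵢ ζᵢ(v)` is a quadratic polynomial in `v` which,
up to constant factors, a rescaling of `v` turns into `(cos θ + v)² - 1`, so that the coefficients
of its `l`-th power are those of the Taylor expansion of `(t² - 1)^l` at `cos θ`. -/

open MvPolynomial

noncomputable section

namespace DipoleRadiation

section PolynomialOperators

variable {σ R : Type*}

theorem aeval_smul_of_isHomogeneous {A : Type*} [CommSemiring R] [CommSemiring A] [Algebra R A]
    {P : MvPolynomial σ R} {n : ℕ} (hP : P.IsHomogeneous n) (r : A) (f : σ → A) :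
    aeval (r • f) P = r ^ n * aeval f P := by
  simp only [aeval_def, eval₂_eq, Finset.mul_sum]
  refine Finset.sum_congr rfl fun d hd => ?_
  simp only [Pi.smul_apply, smul_eq_mul, mul_pow, Finset.prod_mul_distrib,
    Finset.prod_pow_eq_pow_sum]
  have hn : ∑ i ∈ d.support, d i = n := by
    rw [← hP (mem_support_iff.1 hd), Finsupp.weight_apply, Finsupp.sum]
    simp
  rw [hn, mul_left_comm]

variable [CommRing R]

theorem pderiv_comm (i j : σ) (P : MvPolynomial σ R) :
    pderiv i (pderiv j P) = pderiv j (pderiv i P) := by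
  classical
  induction P using MvPolynomial.induction_on with
  | C a => simp
  | add P Q hP hQ => simp [hP, hQ]
  | mul_X P k hP =>
    simp only [Derivation.leibniz, map_add, hP, pderiv_X, Pi.single_apply, smul_eq_mul]
    split_ifs <;> simp [add_comm, add_left_comm]

theorem pderiv_eq_zero_of_isHomogeneous_zero {P : MvPolynomial σ R} (hP : P.IsHomogeneous 0)
    (i : σ) : pderiv i P = 0 := by
  rw [totalDegree_eq_zero_iff_eq_C.1 ((totalDegree_zero_iff_isHomogeneous σ).2 hP), pderiv_C]

/-- The infinitesimal rotation `xᵢ∂ⱼ - xⱼ∂ᵢ` in the plane of the coordinates `i` and `j`. -/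
def rotation (i j : σ) : Derivation R (MvPolynomial σ R) (MvPolynomial σ R) :=
  (X i : MvPolynomial σ R) • pderiv j - (X j : MvPolynomial σ R) • pderiv i

theorem rotation_apply (i j : σ) (P : MvPolynomial σ R) :
    rotation i j P = X i * pderiv j P - X j * pderiv i P := rfl

theorem rotation_pderiv_add_smul_pderiv {i j : σ} (hij : i ≠ j) {P : MvPolynomial σ R} {a s : R}
    (hP : rotation i j P = a • P) (hs : s * s = -1) :
    rotation i j (pderiv i P + s • pderiv j P) = (a + s) • (pderiv i P + s • pderiv j P) := by
  have hi : X i * pderiv i (pderiv j P) + pderiv j P - X j * pderiv i (pderiv i P) =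
      a • pderiv i P := by
    simpa [rotation_apply, pderiv_X_of_ne hij.symm] using congrArg (pderiv i) hP
  have hj : X i * pderiv j (pderiv j P) - (X j * pderiv i (pderiv j P) + pderiv i P) =
      a • pderiv j P := by
    simpa [rotation_apply, pderiv_X_of_ne hij, pderiv_comm j i] using congrArg (pderiv j) hP
  have hs' : (C s * C s : MvPolynomial σ R) = -1 := by rw [← C_mul, hs, C_neg, C_1]
  simp only [rotation_apply, map_add, Derivation.map_smul, pderiv_comm j i]
  simp only [smul_eq_C_mul, C_add] at hi hj ⊢
  linear_combination hi + C s * hj - pderiv j P * hs'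

theorem rotation_pderiv_of_ne {i j k : σ} (hi : k ≠ i) (hj : k ≠ j) {P : MvPolynomial σ R} {a : R}
    (hP : rotation i j P = a • P) : rotation i j (pderiv k P) = a • pderiv k P := by
  rw [← Derivation.map_smul, ← hP]
  simp [rotation_apply, pderiv_X_of_ne hi.symm, pderiv_X_of_ne hj.symm, pderiv_comm k]

variable [Fintype σ]

/-- The Laplace operator on polynomials. -/
def laplacian : MvPolynomial σ R →ₗ[R] MvPolynomial σ R :=
  ∑ i, (pderiv i).toLinearMap ∘ₗ (pderiv i).toLinearMap

theorem laplacian_apply (P : MvPolynomial σ R) : laplacian P = ∑ i, pderiv i (pderiv i P) := by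
  simp [laplacian]

theorem laplacian_pderiv (i : σ) (P : MvPolynomial σ R) :
    laplacian (pderiv i P) = pderiv i (laplacian P) := by
  simp only [laplacian_apply, map_sum, pderiv_comm i]

end PolynomialOperators

section PolynomialFunctions

variable {ι : Type*}

/-- The value of a complex polynomial at a point with real coordinates. -/
def evalAt (x : EuclideanSpace ℝ ι) : MvPolynomial ι ℂ →ₐ[ℂ] ℂ :=
  aeval fun i => (x i : ℂ)

@[simp]
theorem evalAt_X (x : EuclideanSpace ℝ ι) (i : ι) : evalAt x (X i) = x i := aeval_X _ i

@[simp]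
theorem evalAt_C (x : EuclideanSpace ℝ ι) (a : ℂ) : evalAt x (C a) = a := by simp [evalAt]

theorem evalAt_smul {P : MvPolynomial ι ℂ} {d : ℕ} (hP : P.IsHomogeneous d) (r : ℝ)
    (x : EuclideanSpace ℝ ι) : evalAt (r • x) P = (r : ℂ) ^ d * evalAt x P := by
  rw [evalAt, evalAt, ← aeval_smul_of_isHomogeneous hP]
  congr 2
  ext i
  simp

theorem continuous_evalAt (P : MvPolynomial ι ℂ) :
    Continuous fun x : EuclideanSpace ℝ ι => evalAt x P :=
  (MvPolynomial.continuous_eval P).comp (by fun_prop : Continuous fun (x : EuclideanSpace ℝ ι) i =>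
    (x i : ℂ))

variable [Fintype ι]

theorem hasFDerivAt_evalAt (P : MvPolynomial ι ℂ) (x : EuclideanSpace ℝ ι) :
    HasFDerivAt (fun y => evalAt y P) (∑ i, evalAt x (pderiv i P) •
      (Complex.ofRealCLM ∘L EuclideanSpace.proj i : EuclideanSpace ℝ ι →L[ℝ] ℂ)) x := by
  classical
  induction P using MvPolynomial.induction_on with
  | C a =>
    simp only [evalAt_C]
    exact (hasFDerivAt_const a x).congr_fderiv (by ext v; simp)
  | add P Q hP hQ =>
    simp only [map_add]
    refine (hP.add hQ).congr_fderiv ?_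
    ext v
    simp [add_mul, Finset.sum_add_distrib]
  | mul_X P q hP =>
    have hX : HasFDerivAt (fun y => evalAt y (X q))
        (Complex.ofRealCLM ∘L EuclideanSpace.proj q : EuclideanSpace ℝ ι →L[ℝ] ℂ) x := by
      simp only [evalAt_X]
      exact (Complex.ofRealCLM ∘L EuclideanSpace.proj q :
        EuclideanSpace ℝ ι →L[ℝ] ℂ).hasFDerivAt
    simp only [map_mul]
    refine (hP.mul hX).congr_fderiv ?_
    ext v
    simp [Pi.single_apply, pderiv_X, add_mul, Finset.sum_add_distrib, Finset.mul_sum, mul_assoc,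
      apply_ite]

theorem fderiv_evalAt_single {κ : Type*} [Finite κ] [DecidableEq κ] (P : MvPolynomial κ ℂ)
    (x : EuclideanSpace ℝ κ) (i : κ) :
    fderiv ℝ (fun y => evalAt y P) x (EuclideanSpace.single i 1) = evalAt x (pderiv i P) := by
  have := Fintype.ofFinite κ
  rw [(hasFDerivAt_evalAt P x).fderiv]
  simp [apply_ite]

end PolynomialFunctions

section GaussianIntegrals

variable {ι : Type*} [Fintype ι]

/-- The weight `exp (-|x|²)`, complex-valued. -/
def gaussian (x : EuclideanSpace ℝ ι) : ℂ := (Real.exp (-‖x‖ ^ 2) : ℝ)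

theorem norm_gaussian (x : EuclideanSpace ℝ ι) : ‖gaussian x‖ = Real.exp (-‖x‖ ^ 2) := by
  rw [gaussian, Complex.norm_real, Real.norm_of_nonneg (Real.exp_pos _).le]

theorem hasFDerivAt_gaussian (x : EuclideanSpace ℝ ι) :
    HasFDerivAt gaussian (Complex.ofRealCLM ∘L (Real.exp (-‖x‖ ^ 2) • -(2 • innerSL ℝ x))) x :=
  Complex.ofRealCLM.hasFDerivAt.comp x (hasStrictFDerivAt_norm_sq x).hasFDerivAt.neg.exp

theorem fderiv_gaussian_single [DecidableEq ι] (x : EuclideanSpace ℝ ι) (i : ι) :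
    fderiv ℝ gaussian x (EuclideanSpace.single i 1) = -2 * (x i * gaussian x) := by
  rw [(hasFDerivAt_gaussian x).fderiv]
  simp only [smul_neg, ContinuousLinearMap.comp_neg, ContinuousLinearMap.comp_apply, neg_apply,
    smul_apply, coe_innerSL_apply, EuclideanSpace.inner_single_right, Complex.ofRealCLM_apply,
    nsmul_eq_mul, smul_eq_mul, one_mul, conj_trivial, Nat.cast_ofNat, Complex.ofReal_mul,
    Complex.ofReal_ofNat, gaussian]
  ring

theorem integrable_norm_pow_mul_exp_neg_norm_sq (d : ℕ) :
    Integrable fun x : EuclideanSpace ℝ ι => ‖x‖ ^ d * Real.exp (-‖x‖ ^ 2) := by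
  rcases isEmpty_or_nonempty ι with hι | hι
  · exact Integrable.of_finite
  refine (integrable_fun_norm_addHaar (E := EuclideanSpace ℝ ι) volume
    (f := fun r : ℝ => r ^ d * Real.exp (-r ^ 2))).2 ?_
  have h := integrable_rpow_mul_exp_neg_mul_sq one_pos
    (s := (Fintype.card ι - 1 + d : ℕ)) (neg_one_lt_zero.trans_le (Nat.cast_nonneg _))
  refine h.integrableOn.congr_fun (fun r _ => ?_) measurableSet_Ioi
  simp only [finrank_euclideanSpace, Real.rpow_natCast, smul_eq_mul, pow_add, neg_one_mul,
    mul_assoc]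

theorem norm_evalAt_monomial_le (u : ι →₀ ℕ) (a : ℂ) (x : EuclideanSpace ℝ ι) :
    ‖evalAt x (monomial u a)‖ ≤ ‖a‖ * ‖x‖ ^ ∑ i, u i := by
  rw [evalAt, aeval_monomial, norm_mul, Finsupp.prod_fintype _ _ (by simp), norm_prod,
    ← Finset.prod_pow_eq_pow_sum, Algebra.algebraMap_self, RingHom.id_apply]
  gcongr with i
  rw [norm_pow, Complex.norm_real]
  gcongr
  exact PiLp.norm_apply_le x i

theorem integrable_evalAt_mul_gaussian (P : MvPolynomial ι ℂ) :
    Integrable fun x => evalAt x P * gaussian x := by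
  have hcont : Continuous fun x : EuclideanSpace ℝ ι => gaussian x := by unfold gaussian; fun_prop
  induction P using MvPolynomial.induction_on' with
  | monomial u a =>
    refine ((integrable_norm_pow_mul_exp_neg_norm_sq (∑ i, u i)).const_mul ‖a‖).mono'
      ((continuous_evalAt _).mul hcont).aestronglyMeasurable
      (Filter.Eventually.of_forall fun x => ?_)
    rw [norm_mul, norm_gaussian, ← mul_assoc]
    gcongr
    exact norm_evalAt_monomial_le u a x
  | add P Q hP hQ =>
    simp only [map_add, add_mul]
    exact hP.add hQ

/-- The integral of a polynomial against the Gaussian weight `exp (-|x|²)`, as a linear form. -/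
def gaussianIntegral : MvPolynomial ι ℂ →ₗ[ℂ] ℂ where
  toFun P := ∫ x, evalAt x P * gaussian x
  map_add' P Q := by
    simp only [map_add, add_mul]
    exact integral_add (integrable_evalAt_mul_gaussian P) (integrable_evalAt_mul_gaussian Q)
  map_smul' a P := by
    simp only [map_smul, smul_eq_mul, mul_assoc]
    exact integral_const_mul _ _

theorem gaussianIntegral_apply (P : MvPolynomial ι ℂ) :
    gaussianIntegral P = ∫ x, evalAt x P * gaussian x := rfl

theorem gaussianIntegral_pderiv (i : ι) (P : MvPolynomial ι ℂ) :
    gaussianIntegral (pderiv i P) = 2 * gaussianIntegral (X i * P) := by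
  classical
  have hweight (x : EuclideanSpace ℝ ι) :
      evalAt x P * fderiv ℝ gaussian x (EuclideanSpace.single i 1) =
        -2 * (evalAt x (X i * P) * gaussian x) := by
    rw [fderiv_gaussian_single, map_mul, evalAt_X]
    ring
  have hparts := integral_mul_fderiv_eq_neg_fderiv_mul_of_integrable
    (μ := (volume : Measure (EuclideanSpace ℝ ι)))
    (f := fun x => evalAt x P) (g := gaussian) (v := EuclideanSpace.single i 1)
    (by simpa only [fderiv_evalAt_single] using integrable_evalAt_mul_gaussian (pderiv i P))
    (by simpa only [hweight] using (integrable_evalAt_mul_gaussian (X i * P)).const_mul (-2))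
    (integrable_evalAt_mul_gaussian P)
    (fun x _ => (hasFDerivAt_evalAt P x).differentiableAt)
    (fun x _ => (hasFDerivAt_gaussian x).differentiableAt)
  simp only [hweight, fderiv_evalAt_single, integral_const_mul] at hparts
  rw [gaussianIntegral_apply, gaussianIntegral_apply]
  linear_combination hparts

theorem gaussianIntegral_sum_pderiv_mul_pderiv {P Q : MvPolynomial ι ℂ} {n : ℕ}
    (hP : P.IsHomogeneous n) (hharm : laplacian P = 0) :
    gaussianIntegral (∑ i, pderiv i P * pderiv i Q) = 2 * n * gaussianIntegral (P * Q) := by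
  have hdiv : ∑ i, pderiv i P * pderiv i Q = ∑ i, pderiv i (pderiv i P * Q) := by
    simp only [pderiv_mul, Finset.sum_add_distrib, ← Finset.sum_mul, ← laplacian_apply, hharm,
      zero_mul, zero_add]
  have heuler : ∑ i, X i * (pderiv i P * Q) = (n : ℂ) • (P * Q) := by
    simp only [← mul_assoc, ← Finset.sum_mul, hP.sum_X_mul_pderiv, smul_mul_assoc,
      Nat.cast_smul_eq_nsmul]
  rw [hdiv, map_sum]
  simp only [gaussianIntegral_pderiv, ← Finset.mul_sum]
  rw [← map_sum, heuler, map_smul, smul_eq_mul, mul_assoc]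

theorem gaussianIntegral_mul_eq_zero_of_harmonic {P Q : MvPolynomial ι ℂ} {n n' : ℕ}
    (hP : P.IsHomogeneous n) (hQ : Q.IsHomogeneous n') (hPharm : laplacian P = 0)
    (hQharm : laplacian Q = 0) (hn : n ≠ n') : gaussianIntegral (P * Q) = 0 := by
  have hPQ := gaussianIntegral_sum_pderiv_mul_pderiv (Q := Q) hP hPharm
  have hQP := gaussianIntegral_sum_pderiv_mul_pderiv (Q := P) hQ hQharm
  simp only [mul_comm Q P, mul_comm (pderiv _ Q)] at hQP
  have hsub : (n - n' : ℂ) * gaussianIntegral (P * Q) = 0 := by linear_combination (hQP - hPQ) / 2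
  exact (mul_eq_zero.1 hsub).resolve_left (sub_ne_zero.2 (by exact_mod_cast hn))

theorem gaussianIntegral_rotation (i j : ι) (P : MvPolynomial ι ℂ) :
    gaussianIntegral (rotation i j P) = 0 := by
  have hdiv : rotation i j P = pderiv j (X i * P) - pderiv i (X j * P) := by
    classical
    simp [rotation_apply, pderiv_X, Pi.single_apply, eq_comm]
  rw [hdiv, map_sub, gaussianIntegral_pderiv, gaussianIntegral_pderiv, mul_left_comm (X j),
    sub_self]

theorem gaussianIntegral_mul_eq_zero_of_rotation {i j : ι} {P Q : MvPolynomial ι ℂ}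
    {a b : ℂ} (hP : rotation i j P = a • P) (hQ : rotation i j Q = b • Q) (hab : a + b ≠ 0) :
    gaussianIntegral (P * Q) = 0 := by
  have h := gaussianIntegral_rotation i j (P * Q)
  rw [Derivation.leibniz, hP, hQ, smul_eq_mul, smul_eq_mul, mul_smul_comm, mul_smul_comm,
    mul_comm Q, ← add_smul, map_smul, smul_eq_mul, add_comm b] at h
  exact (mul_eq_zero.1 h).resolve_left hab

end GaussianIntegrals

section SphereIntegrals

theorem integral_eq_integral_sphere_prod {E F : Type*} [NormedAddCommGroup E] [NormedSpace ℝ E]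
    [FiniteDimensional ℝ E] [Nontrivial E] [MeasurableSpace E] [BorelSpace E]
    [NormedAddCommGroup F] [NormedSpace ℝ F] (μ : Measure E) [μ.IsAddHaarMeasure] (f : E → F) :
    ∫ x, f x ∂μ = ∫ z, f (z.2.1 • z.1.1)
      ∂(μ.toSphere.prod (Measure.volumeIoiPow (Module.finrank ℝ E - 1))) := by
  have hpolar := μ.measurePreserving_homeomorphUnitSphereProd.integral_comp
    (Homeomorph.measurableEmbedding _) (fun z => f (z.2.1 • z.1.1))
  have hcompl : ∫ x, f x ∂μ = ∫ x : ({0}ᶜ : Set E), f x.1 ∂(μ.comap Subtype.val) := by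
    rw [integral_subtype_comap (measurableSet_singleton _).compl f, restrict_compl_singleton]
  rw [← hpolar, hcompl]
  refine integral_congr_ae (Filter.Eventually.of_forall fun x => ?_)
  have hx : ‖(x : E)‖ ≠ 0 := norm_ne_zero_iff.2 x.2
  simp [smul_smul, hx]

theorem integral_eq_zero_of_integral_sphere_eq_zero {E F : Type*} [NormedAddCommGroup E]
    [NormedSpace ℝ E] [FiniteDimensional ℝ E] [Nontrivial E] [MeasurableSpace E] [BorelSpace E]
    [NormedAddCommGroup F] [NormedSpace ℝ F] {μ : Measure E} [μ.IsAddHaarMeasure] {f : E → F}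
    (h : ∀ r : ℝ, 0 < r → ∫ ω, f (r • ω.1) ∂μ.toSphere = 0) : ∫ x, f x ∂μ = 0 := by
  rw [integral_eq_integral_sphere_prod]
  by_cases hf : Integrable (fun z : Metric.sphere (0 : E) 1 × Set.Ioi (0 : ℝ) =>
      f (z.2.1 • z.1.1)) (μ.toSphere.prod (Measure.volumeIoiPow (Module.finrank ℝ E - 1)))
  · rw [integral_prod_symm _ hf]
    exact integral_eq_zero_of_ae (Filter.Eventually.of_forall fun r => h r.1 r.2)
  · exact integral_undef hf

theorem integral_volumeIoiPow_pow_mul_exp_neg_sq_ne_zero (n d : ℕ) :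
    ∫ r : Set.Ioi (0 : ℝ), (r.1 : ℂ) ^ d * (Real.exp (-r.1 ^ 2) : ℝ)
      ∂(Measure.volumeIoiPow n) ≠ 0 := by
  have hreal : ∫ r : Set.Ioi (0 : ℝ), r.1 ^ d * Real.exp (-r.1 ^ 2) ∂(Measure.volumeIoiPow n) =
      1 / 2 * Real.Gamma (((n + d : ℕ) + 1) / 2) := by
    rw [← integral_rpow_mul_exp_neg_rpow two_pos (neg_one_lt_zero.trans_le (Nat.cast_nonneg _)),
      Measure.volumeIoiPow, integral_withDensity_eq_integral_toReal_smul (by fun_prop) (by simp),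
      integral_subtype_comap measurableSet_Ioi
        fun r : ℝ => (ENNReal.ofReal (r ^ n)).toReal • (r ^ d * Real.exp (-r ^ 2))]
    refine setIntegral_congr_fun measurableSet_Ioi fun r hr => ?_
    have hr' : 0 ≤ r := le_of_lt hr
    simp only [ENNReal.toReal_ofReal (pow_nonneg hr' n), Real.rpow_natCast, Real.rpow_two,
      smul_eq_mul, pow_add, mul_assoc]
  have hcast : ∫ r : Set.Ioi (0 : ℝ), (r.1 : ℂ) ^ d * (Real.exp (-r.1 ^ 2) : ℝ)
      ∂(Measure.volumeIoiPow n) = (1 / 2 * Real.Gamma (((n + d : ℕ) + 1) / 2) : ℝ) := by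
    rw [← hreal, ← integral_complex_ofReal]
    simp only [Complex.ofReal_mul, Complex.ofReal_pow]
  rw [hcast, Complex.ofReal_ne_zero]
  have := Real.Gamma_pos_of_pos (s := ((n + d : ℕ) + 1) / 2) (by positivity)
  positivity

theorem norm_smul_sphere {E : Type*} [NormedAddCommGroup E] [NormedSpace ℝ E] {r : ℝ} (hr : 0 ≤ r)
    (ω : Metric.sphere (0 : E) 1) : ‖r • ω.1‖ = r := by
  rw [norm_smul, norm_eq_of_mem_sphere, mul_one, Real.norm_of_nonneg hr]

variable {ι : Type*} [Fintype ι]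

theorem integrable_evalAt_sphere (P : MvPolynomial ι ℂ) (r : ℝ) :
    Integrable (fun ω : Metric.sphere (0 : EuclideanSpace ℝ ι) 1 => evalAt (r • ω.1) P)
      (volume : Measure (EuclideanSpace ℝ ι)).toSphere :=
  ((continuous_evalAt P).comp
    (continuous_subtype_val.const_smul r)).integrable_of_hasCompactSupport
    (HasCompactSupport.of_compactSpace _)

/-- The integral over directions of a polynomial restricted to the sphere of radius `r`, as a
linear form; the surface measure is that of the unit sphere, without the factor `r ^ (n - 1)`. -/
def sphereIntegral (r : ℝ) : MvPolynomial ι ℂ →ₗ[ℂ] ℂ where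
  toFun P := ∫ ω, evalAt (r • ω.1) P ∂(volume : Measure (EuclideanSpace ℝ ι)).toSphere
  map_add' P Q := by
    simp only [map_add]
    exact integral_add (integrable_evalAt_sphere P r) (integrable_evalAt_sphere Q r)
  map_smul' a P := by
    simp only [map_smul, smul_eq_mul]
    exact integral_const_mul _ _

theorem sphereIntegral_apply (r : ℝ) (P : MvPolynomial ι ℂ) :
    sphereIntegral r P =
      ∫ ω, evalAt (r • ω.1) P ∂(volume : Measure (EuclideanSpace ℝ ι)).toSphere := rfl

theorem gaussianIntegral_eq_sphereIntegral_mul [Nonempty ι] {P : MvPolynomial ι ℂ} {d : ℕ}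
    (hP : P.IsHomogeneous d) : gaussianIntegral P = sphereIntegral 1 P *
      ∫ r : Set.Ioi (0 : ℝ), (r.1 : ℂ) ^ d * (Real.exp (-r.1 ^ 2) : ℝ)
        ∂(Measure.volumeIoiPow (Fintype.card ι - 1)) := by
  rw [gaussianIntegral_apply, integral_eq_integral_sphere_prod, finrank_euclideanSpace,
    sphereIntegral_apply, ← integral_prod_mul]
  refine integral_congr_ae (Filter.Eventually.of_forall fun z => ?_)
  simp only [evalAt_smul hP, gaussian, norm_smul_sphere (le_of_lt z.2.2), one_smul]
  ring

theorem sphereIntegral_eq_zero_of_gaussianIntegral [Nonempty ι] {P : MvPolynomial ι ℂ} {d : ℕ}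
    (hP : P.IsHomogeneous d) (h : gaussianIntegral P = 0) (r : ℝ) : sphereIntegral r P = 0 := by
  rw [gaussianIntegral_eq_sphereIntegral_mul hP] at h
  have hunit := (mul_eq_zero.1 h).resolve_right
    (integral_volumeIoiPow_pow_mul_exp_neg_sq_ne_zero _ d)
  rw [sphereIntegral_apply] at hunit ⊢
  simp only [one_smul] at hunit
  simp only [evalAt_smul hP]
  rw [integral_const_mul, hunit, mul_zero]

end SphereIntegrals

section SelectionRules

/-- `H` is a solid harmonic of degree `l` and magnetic number `m`: a harmonic homogeneous
polynomial of degree `l` on which the infinitesimal rotation about the third axis acts as the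
scalar `i m`. -/
structure IsSolidHarmonic (l : ℕ) (m : ℤ) (H : MvPolynomial (Fin 3) ℂ) : Prop where
  isHomogeneous : H.IsHomogeneous l
  laplacian_eq_zero : laplacian H = 0
  rotation_eq : rotation 0 1 H = (Complex.I * m) • H

namespace IsSolidHarmonic

variable {l l' : ℕ} {m m' : ℤ} {H K : MvPolynomial (Fin 3) ℂ}

theorem gaussianIntegral_pderiv_mul_of_degree (hH : IsSolidHarmonic l m H)
    (hK : IsSolidHarmonic l' m' K) (hl : (l' : ℤ) ≠ l - 1) (p : Fin 3) :
    gaussianIntegral (pderiv p H * K) = 0 := by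
  rcases Nat.eq_zero_or_pos l with rfl | hpos
  · rw [pderiv_eq_zero_of_isHomogeneous_zero hH.isHomogeneous, zero_mul, map_zero]
  · exact gaussianIntegral_mul_eq_zero_of_harmonic hH.isHomogeneous.pderiv hK.isHomogeneous
      (by rw [laplacian_pderiv, hH.laplacian_eq_zero, map_zero]) hK.laplacian_eq_zero (by omega)

theorem gaussianIntegral_pderiv_add_smul_pderiv_mul (hH : IsSolidHarmonic l m H)
    (hK : IsSolidHarmonic l' m' K) {ε : ℤ} (hε : ε * ε = 1) (hm : m + ε + m' ≠ 0) :
    gaussianIntegral ((pderiv 0 H + (Complex.I * ε) • pderiv 1 H) * K) = 0 := by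
  have hsq : Complex.I * ε * (Complex.I * ε) = -1 := by
    rw [mul_mul_mul_comm, Complex.I_mul_I, ← Int.cast_mul, hε, Int.cast_one, mul_one]
  refine gaussianIntegral_mul_eq_zero_of_rotation
    (rotation_pderiv_add_smul_pderiv zero_ne_one hH.rotation_eq hsq) hK.rotation_eq ?_
  rw [← mul_add, ← mul_add]
  exact mul_ne_zero Complex.I_ne_zero (by exact_mod_cast hm)

theorem gaussianIntegral_pderiv_mul_of_magnetic (hH : IsSolidHarmonic l m H)
    (hK : IsSolidHarmonic l' m' K) (h0 : m + m' ≠ 0) (h1 : m + m' ≠ 1) (h2 : m + m' ≠ -1)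
    (p : Fin 3) : gaussianIntegral (pderiv p H * K) = 0 := by
  have hraise := hH.gaussianIntegral_pderiv_add_smul_pderiv_mul hK (ε := 1) rfl (by omega)
  have hlower := hH.gaussianIntegral_pderiv_add_smul_pderiv_mul hK (ε := -1) rfl (by omega)
  simp only [add_mul, smul_mul_assoc, map_add, map_smul, smul_eq_mul, Int.cast_one, Int.cast_neg,
    mul_one, mul_neg, neg_mul] at hraise hlower
  fin_cases p
  · change gaussianIntegral (pderiv 0 H * K) = 0
    linear_combination (hraise + hlower) / 2
  · change gaussianIntegral (pderiv 1 H * K) = 0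
    refine (mul_eq_zero.1 ?_).resolve_left Complex.I_ne_zero
    linear_combination (hraise - hlower) / 2
  · refine gaussianIntegral_mul_eq_zero_of_rotation
      (rotation_pderiv_of_ne (by decide) (by decide) hH.rotation_eq) hK.rotation_eq ?_
    rw [← mul_add]
    exact mul_ne_zero Complex.I_ne_zero (by exact_mod_cast h0)

theorem gaussianIntegral_pderiv_mul (hH : IsSolidHarmonic l m H) (hK : IsSolidHarmonic l' m' K)
    (h : ¬ ((l' : ℤ) = l + 1 ∨ (l' : ℤ) = l - 1) ∨ ¬ (m + m' = 0 ∨ m + m' = 1 ∨ m + m' = -1))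
    (p : Fin 3) : gaussianIntegral (pderiv p H * K) = 0 := by
  rcases h with hl | hm
  · exact hH.gaussianIntegral_pderiv_mul_of_degree hK (by omega) p
  · exact hH.gaussianIntegral_pderiv_mul_of_magnetic hK (by omega) (by omega) (by omega) p

theorem sphereIntegral_pderiv_mul (hH : IsSolidHarmonic l m H) (hK : IsSolidHarmonic l' m' K)
    (h : ¬ ((l' : ℤ) = l + 1 ∨ (l' : ℤ) = l - 1) ∨ ¬ (m + m' = 0 ∨ m + m' = 1 ∨ m + m' = -1))
    (p : Fin 3) (r : ℝ) : sphereIntegral r (pderiv p H * K) = 0 :=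
  sphereIntegral_eq_zero_of_gaussianIntegral (hH.isHomogeneous.pderiv.mul hK.isHomogeneous)
    (hH.gaussianIntegral_pderiv_mul hK h p) r

theorem sphereIntegral_X_mul (hH : IsSolidHarmonic l m H) (hK : IsSolidHarmonic l' m' K)
    (h : ¬ ((l' : ℤ) = l + 1 ∨ (l' : ℤ) = l - 1) ∨ ¬ (m + m' = 0 ∨ m + m' = 1 ∨ m + m' = -1))
    (p : Fin 3) (r : ℝ) : sphereIntegral r (X p * (H * K)) = 0 := by
  refine sphereIntegral_eq_zero_of_gaussianIntegral
    ((isHomogeneous_X _ _).mul (hH.isHomogeneous.mul hK.isHomogeneous)) ?_ r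
  have hparts := gaussianIntegral_pderiv p (H * K)
  rw [pderiv_mul, map_add, mul_comm H, hH.gaussianIntegral_pderiv_mul hK h,
    hK.gaussianIntegral_pderiv_mul hH (by omega), add_zero, mul_comm] at hparts
  simpa using hparts.symm

end IsSolidHarmonic

end SelectionRules

section CoefficientDerivations

open scoped Polynomial

variable {R A : Type*} [CommRing R] [CommRing A] [Algebra R A]

/-- The derivation of `A[X]` that applies a derivation of `A` to every coefficient. -/
def coeffDerivation (d : Derivation R A A) : Derivation R A[X] A[X] :=
  PolynomialModule.equivPolynomialSelf.toLinearMap.compDer d.mapCoeffs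

@[simp]
theorem coeff_coeffDerivation (d : Derivation R A A) (p : A[X]) (k : ℕ) :
    (coeffDerivation d p).coeff k = d (p.coeff k) := rfl

theorem coeffDerivation_C (d : Derivation R A A) (a : A) :
    coeffDerivation d (Polynomial.C a) = Polynomial.C (d a) := by
  ext1 k
  rw [coeff_coeffDerivation, Polynomial.coeff_C, Polynomial.coeff_C, apply_ite d, map_zero]

variable {σ : Type*}

@[simp]
theorem coeffDerivation_map_C (d : Derivation R (MvPolynomial σ R) (MvPolynomial σ R)) (p : R[X]) :
    coeffDerivation d (p.map C) = 0 := by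
  ext1 k
  rw [coeff_coeffDerivation, Polynomial.coeff_map, Polynomial.coeff_zero]
  exact d.map_algebraMap _

theorem coeffDerivation_rotation (i j : σ) (p : (MvPolynomial σ R)[X]) :
    coeffDerivation (rotation i j) p = Polynomial.C (X i) * coeffDerivation (pderiv j) p -
      Polynomial.C (X j) * coeffDerivation (pderiv i) p := by
  ext1 k
  simp [rotation_apply]

theorem isHomogeneous_coeff_pow {p : (MvPolynomial σ R)[X]} {n : ℕ}
    (hp : ∀ k, (p.coeff k).IsHomogeneous n) (l k : ℕ) :
    ((p ^ l).coeff k).IsHomogeneous (n * l) := by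
  induction l generalizing k with
  | zero =>
    rw [pow_zero, Polynomial.coeff_one]
    split_ifs
    · exact isHomogeneous_one _ _
    · exact isHomogeneous_zero _ _ _
  | succ l ih =>
    rw [pow_succ, Polynomial.coeff_mul]
    exact IsHomogeneous.sum _ _ _ fun q _ => (ih q.1).mul (hp q.2)

variable [Fintype σ]

/-- The generic linear form `∑ xᵢ ζᵢ`, with coefficients `ζᵢ` depending polynomially on a
parameter. -/
def linearForm (ζ : σ → R[X]) : (MvPolynomial σ R)[X] :=
  ∑ i, Polynomial.C (X i) * (ζ i).map C

theorem isHomogeneous_coeff_linearForm (ζ : σ → R[X]) (k : ℕ) :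
    ((linearForm ζ).coeff k).IsHomogeneous 1 := by
  simp only [linearForm, Polynomial.finsetSum_coeff, Polynomial.coeff_C_mul, Polynomial.coeff_map]
  exact IsHomogeneous.sum _ _ _ fun i _ => (isHomogeneous_X R i).mul (isHomogeneous_C σ _)

theorem coeffDerivation_pderiv_linearForm (ζ : σ → R[X]) (i : σ) :
    coeffDerivation (pderiv i) (linearForm ζ) = (ζ i).map C := by
  classical
  simp [linearForm, coeffDerivation_C, pderiv_X, Pi.single_apply, apply_ite]

theorem laplacian_coeff_linearForm_pow {ζ : σ → R[X]} (hζ : ∑ i, ζ i ^ 2 = 0) (l k : ℕ) :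
    laplacian ((linearForm ζ ^ l).coeff k) = 0 := by
  have hsecond (i : σ) :
      coeffDerivation (pderiv i) (coeffDerivation (pderiv i) (linearForm ζ ^ l)) =
        l • (l - 1) • (linearForm ζ ^ (l - 1 - 1) * (ζ i ^ 2).map C) := by
    rw [Derivation.leibniz_pow, coeffDerivation_pderiv_linearForm, map_nsmul, smul_eq_mul,
      Derivation.leibniz, coeffDerivation_map_C, smul_zero, zero_add, Derivation.leibniz_pow,
      coeffDerivation_pderiv_linearForm, Polynomial.map_pow, smul_eq_mul, smul_eq_mul,
      mul_smul_comm, mul_left_comm, ← sq]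
  have hsum : ∑ i, coeffDerivation (pderiv i) (coeffDerivation (pderiv i) (linearForm ζ ^ l)) =
      0 := by
    simp only [hsecond, ← Finset.smul_sum, ← Finset.mul_sum, ← Polynomial.map_sum, hζ,
      Polynomial.map_zero, mul_zero, smul_zero]
  rw [laplacian_apply]
  simpa only [Polynomial.finsetSum_coeff, coeff_coeffDerivation, Polynomial.coeff_zero] using
    congrArg (fun p => p.coeff k) hsum

end CoefficientDerivations

section SolidHarmonics

section GeneratingPolynomial

open scoped Polynomial

variable {R : Type*} [CommRing R]

/-- For `s² = -1`, the isotropic vector `(v² - 1, s (v² + 1), 2 v)`: its three components are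
polynomials in `v` whose squares sum to zero. -/
def isotropicVector (s : R) : Fin 3 → R[X] :=
  ![Polynomial.X ^ 2 - 1, Polynomial.C s * (Polynomial.X ^ 2 + 1), 2 * Polynomial.X]

theorem sum_isotropicVector_sq {s : R} (hs : s * s = -1) : ∑ i, isotropicVector s i ^ 2 = 0 := by
  have hC : (Polynomial.C s * Polynomial.C s : R[X]) = -1 := by
    rw [← Polynomial.C_mul, hs, Polynomial.C_neg, Polynomial.C_1]
  simp only [isotropicVector, Fin.sum_univ_three, Matrix.cons_val]
  linear_combination (Polynomial.X ^ 2 + 1) ^ 2 * hC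

theorem linearForm_isotropicVector (s : R) :
    linearForm (isotropicVector s) =
      Polynomial.C (X 0 + C s * X 1) * Polynomial.X ^ 2 +
        Polynomial.C (2 * X 2) * Polynomial.X + Polynomial.C (-(X 0 - C s * X 1)) := by
  simp only [linearForm, isotropicVector, Fin.sum_univ_three, Matrix.cons_val, Polynomial.map_sub,
    Polynomial.map_add, Polynomial.map_mul, Polynomial.map_pow, Polynomial.map_one,
    Polynomial.map_ofNat, Polynomial.map_X, Polynomial.map_C, Polynomial.C_add, Polynomial.C_sub,
    Polynomial.C_neg, Polynomial.C_mul, Polynomial.C_ofNat]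
  ring

theorem coeffDerivation_rotation_linearForm_isotropicVector {s : R} (hs : s * s = -1) :
    coeffDerivation (rotation 0 1) (linearForm (isotropicVector s)) =
      Polynomial.C (C s) * (Polynomial.X * (linearForm (isotropicVector s)).derivative -
        linearForm (isotropicVector s)) := by
  have hC : (Polynomial.C (C s) * Polynomial.C (C s) : (MvPolynomial (Fin 3) R)[X]) = -1 := by
    rw [← Polynomial.C_mul, ← C_mul, hs, C_neg, C_1, Polynomial.C_neg, Polynomial.C_1]
  have hderiv : (linearForm (isotropicVector s)).derivative =
      Polynomial.C (X 0 + C s * X 1) * (2 * Polynomial.X) + Polynomial.C (2 * X 2) := by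
    rw [linearForm_isotropicVector, Polynomial.derivative_add, Polynomial.derivative_add,
      Polynomial.derivative_C_mul, Polynomial.derivative_C_mul_X, Polynomial.derivative_C,
      Polynomial.derivative_X_sq, Polynomial.C_ofNat, add_zero]
  rw [coeffDerivation_rotation, coeffDerivation_pderiv_linearForm,
    coeffDerivation_pderiv_linearForm, hderiv, linearForm_isotropicVector]
  simp only [isotropicVector, Matrix.cons_val, Polynomial.map_sub, Polynomial.map_add,
    Polynomial.map_mul, Polynomial.map_pow, Polynomial.map_one, Polynomial.map_X, Polynomial.map_C,
    Polynomial.C_add, Polynomial.C_sub, Polynomial.C_neg, Polynomial.C_mul]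
  linear_combination -Polynomial.C (X 1) * (Polynomial.X ^ 2 - 1) * hC

theorem coeff_X_mul_derivative (p : R[X]) (k : ℕ) :
    (Polynomial.X * p.derivative).coeff k = k * p.coeff k := by
  cases k with
  | zero => simp
  | succ k => rw [Polynomial.coeff_X_mul, Polynomial.coeff_derivative, mul_comm, Nat.cast_succ]

theorem rotation_coeff_linearForm_isotropicVector_pow {s : R} (hs : s * s = -1) (l k : ℕ) :
    rotation 0 1 ((linearForm (isotropicVector s) ^ l).coeff k) =
      (s * (k - l)) • (linearForm (isotropicVector s) ^ l).coeff k := by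
  set L := linearForm (isotropicVector s) with hL
  have hpow : coeffDerivation (rotation 0 1) (L ^ l) =
      Polynomial.C (C s) * (Polynomial.X * (L ^ l).derivative - l • L ^ l) := by
    rw [Derivation.leibniz_pow, hL, coeffDerivation_rotation_linearForm_isotropicVector hs, ← hL,
      Polynomial.derivative_pow]
    rcases l with _ | l
    · simp
    · simp only [Nat.add_sub_cancel, nsmul_eq_mul, smul_eq_mul, pow_succ, map_natCast]
      ring
  rw [← coeff_coeffDerivation, hpow, Polynomial.coeff_C_mul, Polynomial.coeff_sub,
    coeff_X_mul_derivative, Polynomial.coeff_smul, smul_eq_C_mul, nsmul_eq_mul]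
  simp only [C_mul, C_sub, map_natCast]
  ring

end GeneratingPolynomial

section LegendreCoefficients

open scoped Polynomial

variable {R : Type*} [CommRing R]

theorem coeff_quadratic_pow_of_leadingCoeff_zero (b c : R) (l M : ℕ) :
    ((Polynomial.C c * Polynomial.X + Polynomial.C b) ^ l).coeff (l + M) =
      0 ^ M * ((Polynomial.X ^ 2 + Polynomial.C c * Polynomial.X) ^ l).coeff (l + M) := by
  have hfactor : (Polynomial.X ^ 2 + Polynomial.C c * Polynomial.X : R[X]) =
      Polynomial.X * (Polynomial.X + Polynomial.C c) := by ring
  have hdeg : (Polynomial.C c * Polynomial.X + Polynomial.C b).natDegree ≤ 1 :=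
    Polynomial.natDegree_linear_le
  rcases Nat.eq_zero_or_pos M with rfl | hM
  · have hcoeff := Polynomial.coeff_pow_of_natDegree_le (m := l) hdeg
    rw [mul_one] at hcoeff
    rw [hfactor, mul_pow, add_zero, hcoeff, Polynomial.coeff_X_pow_mul', if_pos le_rfl,
      Nat.sub_self, Polynomial.coeff_zero_eq_eval_zero]
    simp
  · rw [zero_pow hM.ne', zero_mul]
    refine Polynomial.coeff_eq_zero_of_natDegree_lt ?_
    have := Polynomial.natDegree_pow_le_of_le l hdeg
    omega

theorem coeff_quadratic_pow [IsDomain R] (a b c : R) (l M : ℕ) :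
    ((Polynomial.C a * Polynomial.X ^ 2 + Polynomial.C c * Polynomial.X + Polynomial.C b) ^ l).coeff
        (l + M) =
      a ^ M * ((Polynomial.X ^ 2 + Polynomial.C c * Polynomial.X + Polynomial.C (a * b)) ^ l).coeff
        (l + M) := by
  rcases eq_or_ne a 0 with rfl | ha
  · simpa using coeff_quadratic_pow_of_leadingCoeff_zero b c l M
  set P : R[X] := Polynomial.C a * Polynomial.X ^ 2 + Polynomial.C c * Polynomial.X + Polynomial.C b
  set Q : R[X] := Polynomial.X ^ 2 + Polynomial.C c * Polynomial.X + Polynomial.C (a * b)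
  have hcomp : Q.comp (Polynomial.C a * Polynomial.X) = Polynomial.C a * P := by
    simp only [P, Q, Polynomial.add_comp, Polynomial.mul_comp, Polynomial.X_pow_comp,
      Polynomial.X_comp, Polynomial.C_comp, Polynomial.C_mul]
    ring
  have hcoeff : a ^ l * (P ^ l).coeff (l + M) = (Q ^ l).coeff (l + M) * a ^ (l + M) := by
    rw [← Polynomial.comp_C_mul_X_coeff, Polynomial.pow_comp, hcomp, mul_pow, ← Polynomial.C_pow,
      Polynomial.coeff_C_mul]
  refine mul_left_cancel₀ (pow_ne_zero l ha) ?_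
  rw [hcoeff, pow_add]
  ring

theorem eval_iterate_derivative_X_sq_sub_one_pow (l k : ℕ) (t : R) :
    (Polynomial.derivative^[k] ((Polynomial.X ^ 2 - 1 : R[X]) ^ l)).eval t =
      k.factorial * ((Polynomial.X ^ 2 + Polynomial.C (2 * t) * Polynomial.X +
        Polynomial.C (t ^ 2 - 1)) ^ l).coeff k := by
  have htaylor : Polynomial.taylor t (Polynomial.X ^ 2 - 1 : R[X]) =
      Polynomial.X ^ 2 + Polynomial.C (2 * t) * Polynomial.X + Polynomial.C (t ^ 2 - 1) := by
    simp only [Polynomial.taylor_apply, Polynomial.sub_comp, Polynomial.X_pow_comp,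
      Polynomial.one_comp, Polynomial.C_mul, Polynomial.C_sub, Polynomial.C_pow, Polynomial.C_1,
      Polynomial.C_ofNat]
    ring
  rw [← htaylor, ← Polynomial.taylor_pow, Polynomial.taylor_coeff,
    ← Polynomial.factorial_smul_hasseDeriv]
  simp [nsmul_eq_mul]

theorem coeff_quadratic_pow_eq_eval_iterate_derivative [IsDomain R] {a b t : R}
    (hab : a * b = t ^ 2 - 1) (l M : ℕ) :
    ((l + M).factorial : R) * ((Polynomial.C a * Polynomial.X ^ 2 +
        Polynomial.C (2 * t) * Polynomial.X + Polynomial.C b) ^ l).coeff (l + M) =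
      a ^ M * (Polynomial.derivative^[l + M] ((Polynomial.X ^ 2 - 1 : R[X]) ^ l)).eval t := by
  rw [coeff_quadratic_pow, hab, eval_iterate_derivative_X_sq_sub_one_pow]
  ring

end LegendreCoefficients

/-- The root `s = ±i` of `-1` with `s |m| = i m`. -/
def azimuthalUnit (m : ℤ) : ℂ := if 0 ≤ m then Complex.I else -Complex.I

theorem azimuthalUnit_mul_self (m : ℤ) : azimuthalUnit m * azimuthalUnit m = -1 := by
  rw [azimuthalUnit]
  split_ifs <;> simp

theorem azimuthalUnit_mul_natAbs (m : ℤ) : azimuthalUnit m * m.natAbs = Complex.I * m := by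
  rcases le_or_gt 0 m with hm | hm
  · rw [azimuthalUnit, if_pos hm, Nat.cast_natAbs, abs_of_nonneg hm]
  · rw [azimuthalUnit, if_neg hm.not_ge, Nat.cast_natAbs, abs_of_neg hm, Int.cast_neg,
      neg_mul_neg]

theorem exp_azimuthalUnit_mul (m : ℤ) (α : ℝ) :
    Complex.exp (azimuthalUnit m * α) = Real.cos α + azimuthalUnit m * Real.sin α := by
  rw [azimuthalUnit, Complex.ofReal_cos, Complex.ofReal_sin]
  split_ifs
  · rw [mul_comm, Complex.exp_mul_I, mul_comm Complex.I]
  · rw [neg_mul, mul_comm, ← neg_mul, Complex.exp_mul_I, Complex.cos_neg, Complex.sin_neg]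
    ring

/-- The solid harmonic `r^l F_l^m(θ) e^{imφ}`, encoded as a multiple of the coefficient of
`v^{l+|m|}` in the `l`-th power of the linear form of the isotropic vector. -/
def solidHarmonic (l : ℕ) (m : ℤ) : MvPolynomial (Fin 3) ℂ :=
  ((l + m.natAbs).factorial : ℂ) •
    (linearForm (isotropicVector (azimuthalUnit m)) ^ l).coeff (l + m.natAbs)

theorem isSolidHarmonic_solidHarmonic (l : ℕ) (m : ℤ) :
    IsSolidHarmonic l m (solidHarmonic l m) where
  isHomogeneous := by
    have hcoeff := isHomogeneous_coeff_pow
      (isHomogeneous_coeff_linearForm (isotropicVector (azimuthalUnit m))) l (l + m.natAbs)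
    rw [one_mul] at hcoeff
    rw [solidHarmonic, smul_eq_C_mul]
    exact hcoeff.C_mul _
  laplacian_eq_zero := by
    rw [solidHarmonic, map_smul,
      laplacian_coeff_linearForm_pow (sum_isotropicVector_sq (azimuthalUnit_mul_self m)), smul_zero]
  rotation_eq := by
    rw [solidHarmonic, Derivation.map_smul,
      rotation_coeff_linearForm_isotropicVector_pow (azimuthalUnit_mul_self m), Nat.cast_add,
      add_sub_cancel_left, azimuthalUnit_mul_natAbs, smul_comm]

end SolidHarmonics

section SphericalCoordinates

theorem norm_sq_space (x : Space) : ‖x‖ ^ 2 = x 0 ^ 2 + x 1 ^ 2 + x 2 ^ 2 := by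
  simp only [EuclideanSpace.real_norm_sq_eq, Fin.sum_univ_three]

theorem norm_mul_cos_polarAngle {x : Space} (hx : x ≠ 0) :
    ‖x‖ * Real.cos (polarAngle x) = x 2 := by
  have hr : 0 < ‖x‖ := norm_pos_iff.2 hx
  have h := abs_le.1 (PiLp.norm_apply_le x 2)
  rw [polarAngle, Real.cos_arccos (by rw [le_div_iff₀ hr]; linarith) ((div_le_one hr).2 h.2),
    mul_div_cancel₀ _ hr.ne']

theorem norm_mul_sin_polarAngle {x : Space} (hx : x ≠ 0) :
    ‖x‖ * Real.sin (polarAngle x) = ‖(⟨x 0, x 1⟩ : ℂ)‖ := by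
  have hsin : 0 ≤ Real.sin (polarAngle x) :=
    Real.sin_nonneg_of_nonneg_of_le_pi (Real.arccos_nonneg _) (Real.arccos_le_pi _)
  rw [← sq_eq_sq₀ (mul_nonneg (norm_nonneg x) hsin) (norm_nonneg _), Complex.sq_norm,
    Complex.normSq_mk, mul_pow, Real.sin_sq, mul_sub, ← mul_pow, norm_mul_cos_polarAngle hx,
    norm_sq_space]
  ring

theorem norm_mul_sin_polarAngle_mul_cos_azimuth {x : Space} (hx : x ≠ 0) :
    ‖x‖ * Real.sin (polarAngle x) * Real.cos (azimuth x) = x 0 := by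
  rw [norm_mul_sin_polarAngle hx, azimuth, Complex.norm_mul_cos_arg]

theorem norm_mul_sin_polarAngle_mul_sin_azimuth {x : Space} (hx : x ≠ 0) :
    ‖x‖ * Real.sin (polarAngle x) * Real.sin (azimuth x) = x 1 := by
  rw [norm_mul_sin_polarAngle hx, azimuth, Complex.norm_mul_sin_arg]

theorem map_evalAt_linearForm_isotropicVector {x : Space} (hx : x ≠ 0) (s : ℂ) :
    (linearForm (isotropicVector s)).map (evalAt x : MvPolynomial (Fin 3) ℂ →+* ℂ) =
      Polynomial.C (‖x‖ : ℂ) * (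
        Polynomial.C (Real.sin (polarAngle x) *
          (Real.cos (azimuth x) + s * Real.sin (azimuth x))) * Polynomial.X ^ 2 +
        Polynomial.C (2 * (Real.cos (polarAngle x) : ℂ)) * Polynomial.X +
        Polynomial.C (-(Real.sin (polarAngle x) *
          (Real.cos (azimuth x) - s * Real.sin (azimuth x))))) := by
  rw [linearForm_isotropicVector]
  simp only [Polynomial.map_add, Polynomial.map_sub, Polynomial.map_neg, Polynomial.map_mul,
    Polynomial.map_pow, Polynomial.map_ofNat, Polynomial.map_X, Polynomial.map_C,
    RingHom.coe_coe, map_add, map_sub, map_neg, map_mul, map_ofNat, evalAt_X, evalAt_C,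
    ← norm_mul_sin_polarAngle_mul_cos_azimuth hx,
    ← norm_mul_sin_polarAngle_mul_sin_azimuth hx, ← norm_mul_cos_polarAngle hx,
    Complex.ofReal_mul]
  ring

theorem ofReal_polarFactor (l : ℕ) (m : ℤ) (θ : ℝ) :
    (polarFactor l m θ : ℂ) = (Real.sin θ : ℂ) ^ m.natAbs *
      (Polynomial.derivative^[l + m.natAbs] ((Polynomial.X ^ 2 - 1 : Polynomial ℂ) ^ l)).eval
        (Real.cos θ : ℂ) := by
  have hmap : (Polynomial.X ^ 2 - 1 : Polynomial ℂ) ^ l =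
      ((Polynomial.X ^ 2 - 1 : Polynomial ℝ) ^ l).map Complex.ofRealHom := by simp
  rw [polarFactor, hmap, Polynomial.iterate_derivative_map, Complex.ofReal_mul, Complex.ofReal_pow]
  exact congrArg _ (Polynomial.eval_map_apply Complex.ofRealHom _).symm

theorem evalAt_solidHarmonic (l : ℕ) (m : ℤ) {x : Space} (hx : x ≠ 0) :
    evalAt x (solidHarmonic l m) = (‖x‖ : ℂ) ^ l * (polarFactor l m (polarAngle x) *
      Complex.exp (Complex.I * m * azimuth x)) := by
  set s := azimuthalUnit m
  set θ := polarAngle x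
  set α := azimuth x
  have hroots : (Real.sin θ * (Real.cos α + s * Real.sin α) : ℂ) *
      -(Real.sin θ * (Real.cos α - s * Real.sin α)) = (Real.cos θ : ℂ) ^ 2 - 1 := by
    have hθ : (Real.cos θ : ℂ) ^ 2 = 1 - (Real.sin θ : ℂ) ^ 2 := by exact_mod_cast Real.cos_sq' θ
    have hα : (Real.cos α : ℂ) ^ 2 = 1 - (Real.sin α : ℂ) ^ 2 := by exact_mod_cast Real.cos_sq' α
    linear_combination -hθ - (Real.sin θ : ℂ) ^ 2 * hα +
      (Real.sin θ : ℂ) ^ 2 * (Real.sin α : ℂ) ^ 2 * azimuthalUnit_mul_self m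
  have hexp : (Real.cos α + s * Real.sin α : ℂ) ^ m.natAbs = Complex.exp (Complex.I * m * α) := by
    rw [← exp_azimuthalUnit_mul, ← Complex.exp_nat_mul, ← azimuthalUnit_mul_natAbs]
    congr 1
    ring
  have heval (p : Polynomial (MvPolynomial (Fin 3) ℂ)) (k : ℕ) :
      evalAt x (p.coeff k) = (p.map (evalAt x : MvPolynomial (Fin 3) ℂ →+* ℂ)).coeff k :=
    (Polynomial.coeff_map _ _).symm
  rw [solidHarmonic, map_smul, heval, Polynomial.map_pow, map_evalAt_linearForm_isotropicVector hx,
    mul_pow, ← Polynomial.C_pow, Polynomial.coeff_C_mul, smul_eq_mul, mul_left_comm,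
    coeff_quadratic_pow_eq_eval_iterate_derivative hroots, mul_pow, hexp, ofReal_polarFactor]
  ring

/-- The factor `R(r) / r^l` that remains of the radial function of a state of degree `l` when the
solid harmonic is split off. -/
def radialFactor (R : ℝ → ℂ) (l : ℕ) (r : ℝ) : ℂ := R r * ((r : ℂ) ^ l)⁻¹

theorem differentiableAt_radialFactor {R : ℝ → ℂ} {r : ℝ} (hR : DifferentiableAt ℝ R r)
    (hr : r ≠ 0) (l : ℕ) : DifferentiableAt ℝ (radialFactor R l) r :=
  hR.mul ((Complex.ofRealCLM.differentiableAt.pow l).inv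
    (pow_ne_zero _ (Complex.ofReal_ne_zero.2 hr)))

theorem separatedState_eq (R : ℝ → ℂ) (l : ℕ) (m : ℤ) {x : Space} (hx : x ≠ 0) :
    separatedState R l m x = radialFactor R l ‖x‖ * evalAt x (solidHarmonic l m) := by
  have hr : (‖x‖ : ℂ) ≠ 0 := Complex.ofReal_ne_zero.2 (norm_ne_zero_iff.2 hx)
  rw [evalAt_solidHarmonic l m hx, separatedState, radialFactor, mul_assoc (R ‖x‖) (_⁻¹),
    inv_mul_cancel_left₀ (pow_ne_zero l hr), mul_assoc]

end SphericalCoordinates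

section DipoleAmplitude

theorem hasFDerivAt_norm {E : Type*} [NormedAddCommGroup E] [InnerProductSpace ℝ E] {x : E}
    (hx : x ≠ 0) : HasFDerivAt (fun y : E => ‖y‖) (‖x‖⁻¹ • innerSL ℝ x) x := by
  have hr : ‖x‖ ≠ 0 := norm_ne_zero_iff.2 hx
  have hsqrt := (hasStrictFDerivAt_norm_sq x).hasFDerivAt.sqrt (pow_ne_zero 2 hr)
  simp only [Real.sqrt_sq (norm_nonneg _)] at hsqrt
  refine hsqrt.congr_fderiv ?_
  ext v
  simp only [smul_apply, nsmul_eq_mul, smul_eq_mul, Nat.cast_ofNat]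
  field_simp

theorem partialDeriv_radial_mul {g : ℝ → ℂ} {x : Space} (hx : x ≠ 0)
    (hg : DifferentiableAt ℝ g ‖x‖) (P : MvPolynomial (Fin 3) ℂ) (p : Fin 3) :
    partialDeriv p (fun y => g ‖y‖ * evalAt y P) x =
      deriv g ‖x‖ / ‖x‖ * evalAt x (X p * P) + g ‖x‖ * evalAt x (pderiv p P) := by
  have hradial : HasFDerivAt (fun y : Space => g ‖y‖) _ x :=
    hg.hasDerivAt.hasFDerivAt.comp x (hasFDerivAt_norm hx)
  have hprod : HasFDerivAt (fun y : Space => g ‖y‖ * evalAt y P) _ x :=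
    hradial.mul (hasFDerivAt_evalAt P x)
  rw [partialDeriv, hprod.fderiv, add_apply, smul_apply, smul_apply,
    ← (hasFDerivAt_evalAt P x).fderiv, fderiv_evalAt_single]
  simp only [ContinuousLinearMap.comp_apply, ContinuousLinearMap.toSpanSingleton_apply, smul_apply,
    coe_innerSL_apply, EuclideanSpace.inner_single_right, conj_trivial, smul_eq_mul, one_mul,
    Complex.real_smul, Complex.ofReal_mul, Complex.ofReal_inv, map_mul, evalAt_X]
  ring

theorem partialDeriv_separatedState (l : ℕ) (m : ℤ) {R : ℝ → ℂ} {x : Space} (hx : x ≠ 0)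
    (hR : DifferentiableAt ℝ R ‖x‖) (p : Fin 3) :
    partialDeriv p (separatedState R l m) x =
      deriv (radialFactor R l) ‖x‖ / ‖x‖ * evalAt x (X p * solidHarmonic l m) +
        radialFactor R l ‖x‖ * evalAt x (pderiv p (solidHarmonic l m)) := by
  have hev : separatedState R l m =ᶠ[nhds x] fun y =>
      radialFactor R l ‖y‖ * evalAt y (solidHarmonic l m) := by
    filter_upwards [isOpen_compl_singleton.mem_nhds hx] with y hy
    exact separatedState_eq R l m hy
  rw [partialDeriv, hev.fderiv_eq]
  exact partialDeriv_radial_mul hx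
    (differentiableAt_radialFactor hR (norm_ne_zero_iff.2 hx) l) _ p

theorem conj_separatedState (R : ℝ → ℂ) (l : ℕ) (m : ℤ) (x : Space) :
    starRingEnd ℂ (separatedState R l m x) =
      separatedState (fun r => starRingEnd ℂ (R r)) l (-m) x := by
  simp only [separatedState, polarFactor, Int.natAbs_neg, map_mul, Complex.conj_ofReal,
    ← Complex.exp_conj, Complex.conj_I, map_intCast, Int.cast_neg, neg_mul, mul_neg]

theorem partialDeriv_conj (f : Space → ℂ) (p : Fin 3) (x : Space) :
    partialDeriv p (fun y => starRingEnd ℂ (f y)) x = starRingEnd ℂ (partialDeriv p f x) :=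
  DFunLike.congr_fun (Complex.conjCLE.comp_fderiv (f := f) (x := x)) (EuclideanSpace.single p 1)

theorem crossCurrent_apply_eq (hbar e c : ℝ) (A : Space → Space) (ψ ψ' : Space → ℂ) (x : Space)
    (p : Fin 3) :
    crossCurrent hbar e c A ψ ψ' x p =
      kineticMomentum hbar e c A ψ x p * starRingEnd ℂ (ψ' x) +
        starRingEnd ℂ (kineticMomentum hbar e c A ψ' x p) * ψ x := by
  simp [crossCurrent, kineticMomentum, partialDeriv_conj]

theorem integrable_crossCurrent {hbar e c : ℝ} {A : Space → Space} {ψ ψ' : Space → ℂ}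
    (hψ : MemLp ψ 2) (hψ' : MemLp ψ' 2) (hk : MemLp (kineticMomentum hbar e c A ψ) 2)
    (hk' : MemLp (kineticMomentum hbar e c A ψ') 2) :
    Integrable (crossCurrent hbar e c A ψ ψ') := by
  refine Integrable.of_eval_piLp fun p => ?_
  simp only [crossCurrent_apply_eq]
  exact ((hk.eval_piLp p).integrable_mul hψ'.star).add
    ((hk'.eval_piLp p).star.integrable_mul hψ)

theorem isLinearMap_uniformVectorPotential (B : Space) :
    IsLinearMap ℝ (uniformVectorPotential B) where
  map_add x y := by simp [uniformVectorPotential]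
  map_smul a x := by simp [uniformVectorPotential, smul_comm a]

/-- The `p`-th component of a linear vector field, as a linear polynomial. -/
def componentPolynomial (A : Space → Space) (p : Fin 3) : MvPolynomial (Fin 3) ℂ :=
  ∑ q, (A (EuclideanSpace.single q 1) p : ℂ) • X q

theorem evalAt_componentPolynomial {A : Space → Space} (hA : IsLinearMap ℝ A) (p : Fin 3)
    (x : Space) : evalAt x (componentPolynomial A p) = A x p := by
  have hx : x = ∑ q, x q • EuclideanSpace.single q (1 : ℝ) := by
    ext i
    simp [Pi.single_apply]
  have hAx : A x = ∑ q, x q • A (EuclideanSpace.single q 1) := by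
    conv_lhs => rw [hx]
    exact (map_sum hA.mk' _ _).trans (Finset.sum_congr rfl fun q _ => hA.map_smul _ _)
  rw [componentPolynomial, hAx]
  simp only [map_sum, map_smul, smul_eq_mul, evalAt_X, WithLp.ofLp_sum, WithLp.ofLp_smul,
    Finset.sum_apply, Pi.smul_apply, Complex.ofReal_sum, Complex.ofReal_mul, mul_comm]

theorem crossCurrent_separatedState_apply (hbar e c : ℝ) {A : Space → Space}
    (hA : IsLinearMap ℝ A) {R R' : ℝ → ℂ} (l l' : ℕ) (m m' : ℤ) {x : Space} (hx : x ≠ 0)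
    (hR : DifferentiableAt ℝ R ‖x‖) (hR' : DifferentiableAt ℝ R' ‖x‖) (p : Fin 3) :
    let g := radialFactor R l
    let k := radialFactor (fun r => starRingEnd ℂ (R' r)) l'
    let H := solidHarmonic l m
    let K := solidHarmonic l' (-m')
    crossCurrent hbar e c A (separatedState R l m) (separatedState R' l' m') x p = evalAt x
      ((-Complex.I * hbar * (deriv g ‖x‖ * k ‖x‖ - g ‖x‖ * deriv k ‖x‖) / ‖x‖) • (X p * (H * K)) +
        (-Complex.I * hbar * g ‖x‖ * k ‖x‖) • (pderiv p H * K - pderiv p K * H) -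
        (2 * (e / c : ℝ) * g ‖x‖ * k ‖x‖) • (componentPolynomial A p * (H * K))) := by
  intro g k H K
  have hconj : DifferentiableAt ℝ (fun r => starRingEnd ℂ (R' r)) ‖x‖ :=
    Complex.conjCLE.differentiableAt.comp _ hR'
  simp only [crossCurrent, conj_separatedState]
  simp only [partialDeriv_separatedState _ _ hx hR,
    partialDeriv_separatedState _ _ hx hconj, separatedState_eq _ _ _ hx]
  simp only [map_add, map_sub, map_smul, map_mul, smul_eq_mul, evalAt_X,
    evalAt_componentPolynomial hA]
  ring

theorem dipoleAmplitude_separatedState_eq_zero (hbar e c : ℝ) {A : Space → Space}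
    (hA : IsLinearMap ℝ A) {R R' : ℝ → ℂ} (hR : DifferentiableOn ℝ R (Set.Ioi 0))
    (hR' : DifferentiableOn ℝ R' (Set.Ioi 0)) {l l' : ℕ} {m m' : ℤ}
    (hint : Integrable (crossCurrent hbar e c A (separatedState R l m) (separatedState R' l' m')))
    (h : ¬ ((l' : ℤ) = l + 1 ∨ (l' : ℤ) = l - 1) ∨ ¬ (m' = m ∨ m' = m + 1 ∨ m' = m - 1)) :
    dipoleAmplitude hbar e c A (separatedState R l m) (separatedState R' l' m') = 0 := by
  ext p
  rw [dipoleAmplitude, eval_integral_piLp hint.eval_piLp]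
  refine integral_eq_zero_of_integral_sphere_eq_zero fun r hr => ?_
  have hH := isSolidHarmonic_solidHarmonic l m
  have hK := isSolidHarmonic_solidHarmonic l' (-m')
  have hcurrent (ω : Metric.sphere (0 : Space) 1) :=
    crossCurrent_separatedState_apply hbar e c hA l l' m m' (x := r • ω.1)
      (by rw [← norm_ne_zero_iff, norm_smul_sphere hr.le]; exact hr.ne')
      (by rw [norm_smul_sphere hr.le]; exact hR.differentiableAt (Ioi_mem_nhds hr))
      (by rw [norm_smul_sphere hr.le]; exact hR'.differentiableAt (Ioi_mem_nhds hr)) p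
  simp only [norm_smul_sphere hr.le] at hcurrent
  simp only [hcurrent]
  rw [← sphereIntegral_apply]
  have hX (q : Fin 3) := hH.sphereIntegral_X_mul hK (by omega) q r
  simp only [componentPolynomial, Finset.sum_mul, smul_mul_assoc, map_add, map_sub, map_smul,
    map_sum, hX, hH.sphereIntegral_pderiv_mul hK (by omega),
    hK.sphereIntegral_pderiv_mul hH (by omega), smul_zero, sub_zero, add_zero,
    Finset.sum_const_zero]

end DipoleAmplitude

end DipoleRadiation

end

theorem mainTheorem8_general (hbar e c : ℝ) (_hc : c ≠ 0)
    {A : DipoleRadiation.Space → DipoleRadiation.Space} (hA : IsLinearMap ℝ A) {R R' : ℝ → ℂ}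
    (hR : DifferentiableOn ℝ R (Set.Ioi 0)) (hR' : DifferentiableOn ℝ R' (Set.Ioi 0))
    {l l' : ℕ} {m m' : ℤ}
    (hψ : MemLp (DipoleRadiation.separatedState R l m) 2)
    (hψ' : MemLp (DipoleRadiation.separatedState R' l' m') 2)
    (hk : MemLp (DipoleRadiation.kineticMomentum hbar e c A
      (DipoleRadiation.separatedState R l m)) 2)
    (hk' : MemLp (DipoleRadiation.kineticMomentum hbar e c A
      (DipoleRadiation.separatedState R' l' m')) 2) :
    Integrable (DipoleRadiation.crossCurrent hbar e c A
      (DipoleRadiation.separatedState R l m) (DipoleRadiation.separatedState R' l' m')) ∧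
    ((¬ ((l' : ℤ) = l + 1 ∨ (l' : ℤ) = l - 1) ∨ ¬ (m' = m ∨ m' = m + 1 ∨ m' = m - 1)) →
      DipoleRadiation.dipoleAmplitude hbar e c A
        (DipoleRadiation.separatedState R l m) (DipoleRadiation.separatedState R' l' m') = 0) :=
  have hint := DipoleRadiation.integrable_crossCurrent hψ hψ' hk hk'
  ⟨hint, DipoleRadiation.dipoleAmplitude_separatedState_eq_zero hbar e c hA hR hR' hint⟩

theorem mainTheorem8
    (hbar μ e c κ : ℝ) (hhbar : 0 < hbar) (hμ : 0 < μ) (hc : 0 < c) (hκ : κ = 0 ∨ κ = 1)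
    (φ : ℝ → ℝ) (hφ : MeasureTheory.LocallyIntegrableOn φ (Set.Ioi 0))
    (B : DipoleRadiation.Space)
    (E E' : ℝ) (R R' : ℝ → ℂ) (l l' : ℕ) (m m' : ℤ) (hm : |m| ≤ l) (hm' : |m'| ≤ l')
    (hψ : DipoleRadiation.IsStationaryState hbar μ e c κ φ B E R l m)
    (hψ' : DipoleRadiation.IsStationaryState hbar μ e c κ φ B E' R' l' m') :
    MeasureTheory.Integrable
      (DipoleRadiation.crossCurrent hbar e c (DipoleRadiation.uniformVectorPotential B)
        (DipoleRadiation.separatedState R l m) (DipoleRadiation.separatedState R' l' m')) ∧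
    ((¬ ((l' : ℤ) = l + 1 ∨ (l' : ℤ) = l - 1) ∨ ¬ (m' = m ∨ m' = m + 1 ∨ m' = m - 1)) →
      DipoleRadiation.dipoleAmplitude hbar e c (DipoleRadiation.uniformVectorPotential B)
        (DipoleRadiation.separatedState R l m) (DipoleRadiation.separatedState R' l' m') = 0) :=
  mainTheorem8_general hbar e c hc.ne' (DipoleRadiation.isLinearMap_uniformVectorPotential B)
    (hψ.contDiffOn.differentiableOn one_ne_zero) (hψ'.contDiffOn.differentiableOn one_ne_zero)
    hψ.memLp hψ'.memLp hψ.kinetic_memLp hψ'.kinetic_memLp
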